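/- **Proposition 4.4 (Kan-injectivity).** An *order-enriched* category is a category $\mathcal L$ whose hom-sets are posets, with composition monotone in both variables. It is called *order-enriched locally presentable* if for some regular cardinal $\lambda$: 1. its underlying ordinary category is locally $\lambda$-presentable; 2. for all $f_1,f_2:L\to L'$, if $f_1u\le f_2u$ for every morphism $u:K\to L$ with $K$ $\lambda$-presentable, then $f_1\le f_2$; 3. it has copowers with the two-element chain in the enriched sense: for every object $L$ there are an object $T$ and morphisms $i_0\le i_1:L\to T$ such that for every object $L'$ the map $t\mapsto(ti_0,ti_1)$ is an isomorphism of posets from $\mathcal L(T,L')$ onto $\{(f,g)\in\mathcal L(L,L')^2: f\le g\}$, ordered componentwise. Let $\mathcal H$ be a (small) set of morphisms of an order-enriched locally presentable category $\mathcal L$. For $h:X\to Y$ in $\mathcal H$ and $f:X\to K$, a left Kan extension of $f$ along $h$ is a morphism $f/h:Y\to K$ with $f\le (f/h)h$ such that, for every $g:Y\to K$, $f\le gh$ implies $f/h\le g$. Let $\mathcal L\,\mathrm{Inj}(\mathcal H)$ be the (not necessarily full) subcategory of $\mathcal L$ whose objects are those $K$ for which $f/h$ exists for every $h:X\to Y$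 in $\mathcal H$ and every $f:X\to K$, and whose morphisms are the morphisms $u:K\to K'$ of $\mathcal L$ between such objects with $u\,(f/h)=(uf)/h$ for every $h:X\to Y$ in $\mathcal H$ and every $f:X\to K$. Then $\mathcal L\,\mathrm{Inj}(\mathcal H)$ is reflective in $\mathcal L$, i.e. the embedding $\mathcal L\,\mathrm{Inj}(\mathcal H)\hookrightarrow\mathcal L$ has a left adjoint. -/

import Mathlib

open CategoryTheory

universe v u

/-- An enrichment of a category over the category of posets: every hom-set is partially ordered
and composition is monotone in both variables. -/
class OrderEnriched (L : Type u) [Category.{v} L] where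
  homOrder : ∀ X Y : L, PartialOrder (X ⟶ Y)
  comp_le_comp : ∀ {X Y Z : L} {f f' : X ⟶ Y} {g g' : Y ⟶ Z},
    f ≤ f' → g ≤ g' → f ≫ g ≤ f' ≫ g'

attribute [reducible, instance] OrderEnriched.homOrder

section

variable {L : Type u} [Category.{v} L] [OrderEnriched L]

/-- `T`, with the pair `i₀ ≤ i₁`, is a copower (tensor), in the poset-enriched sense, of `X` with
the two-element chain: composition with `i₀` and `i₁` is an isomorphism of posets from `T ⟶ Y` to
the poset of pairs `f ≤ g` of morphisms `X ⟶ Y`. (Uniqueness of the induced morphism follows from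
`le_of_comp_le` by antisymmetry.) -/
structure IsChainCopower {X T : L} (i₀ i₁ : X ⟶ T) : Prop where
  le : i₀ ≤ i₁
  exists_desc : ∀ {Y : L} (f g : X ⟶ Y), f ≤ g → ∃ t : T ⟶ Y, i₀ ≫ t = f ∧ i₁ ≫ t = g
  le_of_comp_le : ∀ {Y : L} (t t' : T ⟶ Y), i₀ ≫ t ≤ i₀ ≫ t' → i₁ ≫ t ≤ i₁ ≫ t' → t ≤ t'

variable (L) in
/-- Order-enriched locally `κ`-presentable categories. -/
structure IsOrderEnrichedCardinalLocallyPresentable (κ : Cardinal.{v}) [Fact κ.IsRegular] :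
    Prop where
  /-- the underlying ordinary category is locally `κ`-presentable -/
  locallyPresentable : IsCardinalLocallyPresentable L κ
  /-- the order of parallel morphisms is detected by the `κ`-presentable objects -/
  le_of_presentable : ∀ {X Y : L} (f g : X ⟶ Y),
    (∀ (K : L) (_ : IsCardinalPresentable K κ) (u : K ⟶ X), u ≫ f ≤ u ≫ g) → f ≤ g
  /-- copowers with the two-element chain exist -/
  exists_copower : ∀ X : L, ∃ (T : L) (i₀ i₁ : X ⟶ T), IsChainCopower i₀ i₁

variable (L) in
/-- Order-enriched locally presentable categories. -/
def IsOrderEnrichedLocallyPresentable : Prop :=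
  ∃ (κ : Cardinal.{v}) (_ : Fact κ.IsRegular), IsOrderEnrichedCardinalLocallyPresentable L κ

/-- `e : Y ⟶ K` is a left Kan extension `f/h` of `f : X ⟶ K` along `h : X ⟶ Y`. -/
structure IsKanExtension {X Y K : L} (h : X ⟶ Y) (f : X ⟶ K) (e : Y ⟶ K) : Prop where
  le : f ≤ h ≫ e
  least : ∀ g : Y ⟶ K, f ≤ h ≫ g → e ≤ g

/-- Left Kan extensions are unique, so that `f/h` is well defined. -/
theorem IsKanExtension.unique {X Y K : L} {h : X ⟶ Y} {f : X ⟶ K} {e e' : Y ⟶ K}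
    (he : IsKanExtension h f e) (he' : IsKanExtension h f e') : e = e' :=
  le_antisymm (he.least _ he'.le) (he'.least _ he.le)

/-- `K` is Kan-injective with respect to every member of `H`. -/
def IsKanInjective (H : MorphismProperty L) (K : L) : Prop :=
  ∀ ⦃X Y : L⦄ (h : X ⟶ Y), H h → ∀ f : X ⟶ K, ∃ e : Y ⟶ K, IsKanExtension h f e

/-- `u : K ⟶ K'` preserves Kan extensions along the members of `H`: whenever `f/h` exists,
its composite with `u` is the Kan extension of the composite of `f` with `u`. -/
def PreservesKanExtensions (H : MorphismProperty L) {K K' : L} (u : K ⟶ K') : Prop :=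
  ∀ ⦃X Y : L⦄ (h : X ⟶ Y), H h → ∀ (f : X ⟶ K) (e : Y ⟶ K),
    IsKanExtension h f e → IsKanExtension h (f ≫ u) (e ≫ u)

/-- On Kan-injective objects, preservation of Kan extensions is the equation
`u · (f/h) = (u · f)/h`. -/
theorem preservesKanExtensions_iff {H : MorphismProperty L} {K K' : L} (hK' : IsKanInjective H K')
    (u : K ⟶ K') :
    PreservesKanExtensions H u ↔ ∀ ⦃X Y : L⦄ (h : X ⟶ Y), H h → ∀ (f : X ⟶ K) (e : Y ⟶ K)
      (e' : Y ⟶ K'), IsKanExtension h f e → IsKanExtension h (f ≫ u) e' → e ≫ u = e' := by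
  constructor
  · intro hu X Y h hh f e e' he he'
    exact (hu h hh f e he).unique he'
  · intro hu X Y h hh f e he
    obtain ⟨e', he'⟩ := hK' h hh (f ≫ u)
    rw [hu h hh f e e' he he']
    exact he'

/-- The objects of the subcategory `L Inj(H)`. -/
structure KanInj (H : MorphismProperty L) where
  obj : L
  isKanInjective : IsKanInjective H obj

namespace KanInj

variable {H : MorphismProperty L}

/-- The morphisms of the subcategory `L Inj(H)`. -/
@[ext]
structure Hom (K K' : KanInj H) where
  hom : K.obj ⟶ K'.obj
  preserves : PreservesKanExtensions H hom

/-- The subcategory `L Inj(H)`, with identities and composition of `L`. -/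
instance : Category.{v} (KanInj H) where
  Hom := Hom
  id K := ⟨𝟙 K.obj, fun _ _ _ _ _ _ he => by simpa using he⟩
  comp a b := ⟨a.hom ≫ b.hom, fun _ _ h hh f e he => by
    simpa using b.preserves h hh _ _ (a.preserves h hh f e he)⟩
  id_comp _ := Hom.ext (Category.id_comp _)
  comp_id _ := Hom.ext (Category.comp_id _)
  assoc _ _ _ := Hom.ext (Category.assoc _ _ _)

variable (H) in
/-- The embedding of `L Inj(H)` in `L`. -/
def embedding : KanInj H ⥤ L where
  obj K := K.obj
  map a := a.hom
  map_id _ := rfl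
  map_comp _ _ := rfl

end KanInj

end

/-! `KanInj H` is not full in `L`, so it cannot be an orthogonality class there. It becomes one once
the Kan extensions are recorded as structure. For `h i : X i ⟶ Y i`, let `B i` be the universal lax
triangle over `h i`, and equip objects with sets of marked morphisms from the `B i`. Marking every
Kan extension embeds `KanInj H` fully in `MarkedObj B`. The image is the class of objects local with
respect to a small set of morphisms between presentable objects (`exists_isLocal_eq_isKan`): one
family makes each `X i ⟶ M.obj` extend to a unique mark, the other makes marks minimal, an
inequality being a factorization through a coinserter. Such a class is reflective, and `forget B`
has the left adjoint `free B`; composing gives the reflection. -/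

open Limits

/-! ### Presentability ranks -/

/-- Any small family of presentable objects is `κ`-presentable for a common `κ`. -/
theorem exists_isCardinalPresentable_family {L : Type u} [Category.{v} L] {ι : Type v}
    (A : ι → L) [∀ i, IsPresentable.{v} (A i)] :
    ∃ (κ : Cardinal.{v}) (_ : Fact κ.IsRegular), ∀ i, IsCardinalPresentable (A i) κ := by
  choose κ hκ hA using fun i ↦ Functor.IsAccessible.exists_cardinal.{v}
    (F := coyoneda.obj (Opposite.op (A i)))
  -- The supremum of the ranks need not be regular; an infinite successor cardinal is.
  refine ⟨Order.succ (max Cardinal.aleph0 (⨆ i, κ i)),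
    ⟨Cardinal.isRegular_succ (le_max_left _ _)⟩, fun i ↦ ?_⟩
  have : Fact (Order.succ (max Cardinal.aleph0 (⨆ i, κ i))).IsRegular :=
    ⟨Cardinal.isRegular_succ (le_max_left _ _)⟩
  have hi : κ i ≤ Order.succ (max Cardinal.aleph0 (⨆ i, κ i)) :=
    ((le_ciSup (Cardinal.bddAbove_of_small) i).trans (le_max_right _ _)).trans (Order.le_succ _)
  have : IsCardinalPresentable (A i) (κ i) := hA i
  exact isCardinalPresentable_of_le (A i) hi

theorem isCardinalPresentable_pushout {C : Type u} [Category.{v} C] [HasPushouts C]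
    (κ : Cardinal.{v}) [Fact κ.IsRegular] {X Y Z : C} (f : X ⟶ Y) (g : X ⟶ Z)
    (hX : IsCardinalPresentable X κ) (hY : IsCardinalPresentable Y κ)
    (hZ : IsCardinalPresentable Z κ) : IsCardinalPresentable (pushout f g) κ := by
  have : ∀ k, IsCardinalPresentable ((span f g).obj k) κ := by
    rintro (_ | _ | _) <;> assumption
  refine isCardinalPresentable_of_isColimit (colimit.cocone (span f g)) (colimit.isColimit _) κ ?_
  have : Finite (Arrow WalkingSpan) := by
    have : Finite (Σ (a b : WalkingSpan), a ⟶ b) := inferInstance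
    exact Finite.of_injective (fun f : Arrow WalkingSpan ↦
      (⟨f.left, f.right, f.hom⟩ : Σ (a b : WalkingSpan), a ⟶ b)) (by
        rintro ⟨a, b, f⟩ ⟨a', b', f'⟩ h
        obtain rfl : a = a' := congrArg (·.1) h
        obtain ⟨rfl, h⟩ := Sigma.mk.inj (eq_of_heq (Sigma.mk.inj h).2)
        obtain rfl := eq_of_heq h
        rfl)
  exact HasCardinalLT.of_le (hasCardinalLT_of_finite _ _ le_rfl) (Fact.out : κ.IsRegular).aleph0_le

/-! ### Coinserters and lax triangles -/

section

variable {L : Type u} [Category.{v} L] [OrderEnriched L]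

/-- In an order-enriched category with pushouts, binary coproducts and copowers with the
two-element chain, every parallel pair has a coinserter. -/
theorem exists_coinserter [HasPushouts L] [HasBinaryCoproducts L]
    (hT : ∀ X : L, ∃ (T : L) (i₀ i₁ : X ⟶ T), IsChainCopower i₀ i₁) {Y C : L} (a b : Y ⟶ C) :
    ∃ (C' : L) (p : C ⟶ C'), Epi p ∧
      ∀ {K : L} (m : C ⟶ K), a ≫ m ≤ b ≫ m ↔ ∃ m' : C' ⟶ K, p ≫ m' = m := by
  obtain ⟨T, i₀, i₁, h⟩ := hT Y
  have : Epi (coprod.desc i₀ i₁) := ⟨fun s t e ↦ by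
    have e₀ : i₀ ≫ s = i₀ ≫ t := by
      simpa [coprod.inl_desc] using coprod.inl ≫= e
    have e₁ : i₁ ≫ s = i₁ ≫ t := by
      simpa [coprod.inr_desc] using coprod.inr ≫= e
    exact le_antisymm (h.le_of_comp_le _ _ e₀.le e₁.le) (h.le_of_comp_le _ _ e₀.ge e₁.ge)⟩
  -- A morphism out of this pushout is an `m` for which the pair `a ≫ m`, `b ≫ m` extends to `T`,
  -- that is, is ordered.
  refine ⟨pushout (coprod.desc i₀ i₁) (coprod.desc a b), pushout.inr _ _, inferInstance,
    fun m ↦ ⟨fun hm ↦ ?_, ?_⟩⟩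
  · obtain ⟨t, ht₀, ht₁⟩ := h.exists_desc _ _ hm
    exact ⟨pushout.desc t m (by ext <;> simp [coprod.inl_desc, coprod.inr_desc, ht₀, ht₁]), pushout.inr_desc _ _ _⟩
  · rintro ⟨m', rfl⟩
    have e := pushout.condition (f := coprod.desc i₀ i₁) (g := coprod.desc a b)
    set j := pushout.inl (coprod.desc i₀ i₁) (coprod.desc a b)
    set p := pushout.inr (coprod.desc i₀ i₁) (coprod.desc a b)
    have e₀ : i₀ ≫ j = a ≫ p := by
      simpa [coprod.inl_desc] using coprod.inl ≫= e
    have e₁ : i₁ ≫ j = b ≫ p := by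
      simpa [coprod.inr_desc] using coprod.inr ≫= e
    rw [← Category.assoc, ← Category.assoc, ← e₀, ← e₁]
    exact OrderEnriched.comp_le_comp (OrderEnriched.comp_le_comp h.le le_rfl) le_rfl

/-- `B`, with `x` and `y`, is the universal object with a lax triangle `x ≤ h ≫ y`. -/
structure IsLaxTriangle {X Y B : L} (h : X ⟶ Y) (x : X ⟶ B) (y : Y ⟶ B) : Prop where
  le : x ≤ h ≫ y
  exists_desc : ∀ {K : L} (f : X ⟶ K) (e : Y ⟶ K), f ≤ h ≫ e → ∃ m : B ⟶ K, x ≫ m = f ∧ y ≫ m = e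
  hom_ext : ∀ {K : L} (m m' : B ⟶ K), x ≫ m = x ≫ m' → y ≫ m = y ≫ m' → m = m'

/-- `B` is the coinserter of the two morphisms `X ⟶ X ⨿ Y` given by `coprod.inl` and `h ≫
coprod.inr`. -/
theorem exists_isLaxTriangle [HasPushouts L] [HasBinaryCoproducts L]
    (hT : ∀ X : L, ∃ (T : L) (i₀ i₁ : X ⟶ T), IsChainCopower i₀ i₁) {X Y : L} (h : X ⟶ Y) :
    ∃ (B : L) (x : X ⟶ B) (y : Y ⟶ B), IsLaxTriangle h x y := by
  obtain ⟨B, p, _, hp⟩ := exists_coinserter hT (coprod.inl : X ⟶ X ⨿ Y) (h ≫ coprod.inr)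
  refine ⟨B, coprod.inl ≫ p, coprod.inr ≫ p, ?_, fun f e hfe ↦ ?_, fun m m' h₁ h₂ ↦ ?_⟩
  · simpa using (hp p).2 ⟨𝟙 _, by simp⟩
  · obtain ⟨m, hm⟩ := (hp (coprod.desc f e)).1 (by simpa [coprod.inl_desc, coprod.inr_desc] using hfe)
    exact ⟨m, by simp [coprod.inl_desc, hm], by simp [coprod.inr_desc, hm]⟩
  · rw [← cancel_epi p]
    ext
    · simpa using h₁
    · simpa using h₂

theorem IsLaxTriangle.comp_le {X Y B K : L} {h : X ⟶ Y} {x : X ⟶ B} {y : Y ⟶ B}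
    (hB : IsLaxTriangle h x y) (m : B ⟶ K) : x ≫ m ≤ h ≫ y ≫ m := by
  rw [← Category.assoc]
  exact OrderEnriched.comp_le_comp hB.le le_rfl

end

/-! ### Marked objects: colimits, free objects, generic marks -/

/-- An object of a category together with, for each `i`, a set of marked morphisms from `B i`. -/
structure MarkedObj {L : Type u} [Category.{v} L] {ι : Type v} (B : ι → L) where
  obj : L
  mark : ι → Type v
  hom : ∀ i, mark i → (B i ⟶ obj)

namespace MarkedObj

variable {L : Type u} [Category.{v} L] {ι : Type v} {B : ι → L}

/-- Morphisms of objects with marked morphisms. -/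
@[ext]
structure Hom (M N : MarkedObj B) where
  base : M.obj ⟶ N.obj
  map : ∀ i, M.mark i → N.mark i
  w : ∀ i q, N.hom i (map i q) = M.hom i q ≫ base

instance : Category.{v} (MarkedObj B) where
  Hom := Hom
  id M := ⟨𝟙 _, fun _ q ↦ q, by simp⟩
  comp f g := ⟨f.base ≫ g.base, fun i q ↦ g.map i (f.map i q), by simp [f.w, g.w]⟩

theorem hom_ext {M N : MarkedObj B} {f g : M ⟶ N} (h : f.base = g.base)
    (h' : ∀ i q, f.map i q = g.map i q) : f = g :=
  Hom.ext h (by ext i q; exact h' i q)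

variable (B) in
/-- The underlying object. -/
@[simps]
def forget : MarkedObj B ⥤ L where
  obj M := M.obj
  map f := f.base

variable (B) in
/-- The set of marks at a given index. -/
@[simps]
def marks (i : ι) : MarkedObj B ⥤ Type v where
  obj M := M.mark i
  map f := TypeCat.ofHom (f.map i)

section Colimits

variable {J : Type v} [SmallCategory J] [HasColimitsOfSize.{v, v} L] (F : J ⥤ MarkedObj B)

/-- The cocone on a diagram of marked objects with componentwise colimits. -/
noncomputable def colimitCocone : Cocone F where
  pt :=
    { obj := colimit (F ⋙ forget B)
      mark i := colimit (F ⋙ marks B i)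
      hom i := colimit.desc (F ⋙ marks B i)
        { pt := B i ⟶ colimit (F ⋙ forget B)
          ι :=
            { app j := TypeCat.ofHom fun q ↦ (F.obj j).hom i q ≫ colimit.ι (F ⋙ forget B) j
              naturality j k f := by
                ext q
                exact (congrArg (· ≫ colimit.ι (F ⋙ forget B) k) ((F.map f).w i q)).trans
                  ((Category.assoc _ _ _).trans
                    (congrArg _ (colimit.w (F ⋙ forget B) f))) } } }
  ι :=
    { app j :=
        { base := colimit.ι (F ⋙ forget B) j
          map i := colimit.ι (F ⋙ marks B i) j
          w i q := colimit.ι_desc_apply _ _ _ }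
      naturality j k f := hom_ext
        ((colimit.w (F ⋙ forget B) f).trans (Category.comp_id _).symm)
        fun i q ↦ colimit.w_apply (F ⋙ marks B i) f q }

/-- Componentwise colimits of marked objects are colimits. -/
noncomputable def isColimitColimitCocone : IsColimit (colimitCocone F) where
  desc s :=
    { base := colimit.desc (F ⋙ forget B) ((forget B).mapCocone s)
      map i := colimit.desc (F ⋙ marks B i) ((marks B i).mapCocone s)
      w i q := by
        obtain ⟨j, q, rfl⟩ := Types.jointly_surjective' q
        have h₁ := colimit.ι_desc_apply ((marks B i).mapCocone s) j q
        have h₂ : (colimitCocone F).pt.hom i (colimit.ι (F ⋙ marks B i) j q) =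
            (F.obj j).hom i q ≫ colimit.ι (F ⋙ forget B) j := colimit.ι_desc_apply _ _ _
        refine (congrArg (s.pt.hom i) h₁).trans (((s.ι.app j).w i q).trans ?_)
        refine Eq.trans ?_
          (congrArg (· ≫ colimit.desc (F ⋙ forget B) ((forget B).mapCocone s)) h₂).symm
        exact ((Category.assoc _ _ _).trans
          (congrArg _ (colimit.ι_desc ((forget B).mapCocone s) j))).symm }
  fac s j := hom_ext (colimit.ι_desc ((forget B).mapCocone s) j)
    fun i q ↦ colimit.ι_desc_apply ((marks B i).mapCocone s) j q
  uniq s m hm := by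
    refine hom_ext (colimit.hom_ext fun j ↦ ?_) fun i q ↦ ?_
    · exact (congrArg Hom.base (hm j)).trans (colimit.ι_desc ((forget B).mapCocone s) j).symm
    · obtain ⟨j, q, rfl⟩ := Types.jointly_surjective' q
      refine Eq.trans ?_
        (colimit.ι_desc_apply ((marks B i).mapCocone s) j q).symm
      exact congrArg (fun f : F.obj j ⟶ s.pt ↦ f.map i q) (hm j)

end Colimits

section

variable [HasColimitsOfSize.{v, v} L]

instance : HasColimitsOfSize.{v, v} (MarkedObj B) where
  has_colimits_of_shape _ _ := ⟨fun F ↦ ⟨_, isColimitColimitCocone F⟩⟩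

instance : PreservesColimitsOfSize.{v, v} (forget B) where
  preservesColimitsOfShape := ⟨fun {F} ↦
    preservesColimit_of_preserves_colimit_cocone (isColimitColimitCocone F)
      (colimit.isColimit (F ⋙ forget B))⟩

instance (i : ι) : PreservesColimitsOfSize.{v, v} (marks B i) where
  preservesColimitsOfShape := ⟨fun {F} ↦
    preservesColimit_of_preserves_colimit_cocone (isColimitColimitCocone F)
      (colimit.isColimit (F ⋙ marks B i))⟩

end

variable (B) in
/-- The marked objects without marks. -/
@[simps]
def free : L ⥤ MarkedObj B where
  obj K := ⟨K, fun _ ↦ PEmpty, fun _ q ↦ q.elim⟩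
  map f := ⟨f, fun _ q ↦ q, fun _ q ↦ q.elim⟩

/-- The morphism of marked objects out of an object without marks. -/
def freeDesc {K : L} {M : MarkedObj B} (f : K ⟶ M.obj) : (free B).obj K ⟶ M :=
  ⟨f, fun _ q ↦ q.elim, fun _ q ↦ q.elim⟩

@[simp] theorem freeDesc_base {K : L} {M : MarkedObj B} (f : K ⟶ M.obj) :
    (freeDesc f : (free B).obj K ⟶ M).base = f := rfl

theorem free_hom_ext {K : L} {M : MarkedObj B} {f g : (free B).obj K ⟶ M}
    (h : f.base = g.base) : f = g :=
  hom_ext h fun _ q ↦ q.elim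

variable (B) in
/-- The adjunction between marked objects without marks and the forgetful functor. -/
def freeAdj : free B ⊣ forget B :=
  Adjunction.mkOfHomEquiv
    { homEquiv _ _ :=
        { toFun f := f.base
          invFun f := freeDesc f
          left_inv _ := free_hom_ext rfl
          right_inv _ := rfl }
      homEquiv_naturality_left_symm _ _ := free_hom_ext rfl
      homEquiv_naturality_right _ _ := rfl }

variable (B) in
/-- The universal marked object with a mark at `i`. -/
def generic (i : ι) : MarkedObj B where
  obj := B i
  mark j := ULift (PLift (i = j))
  hom _ q := eqToHom (congrArg B q.down.down.symm)

variable (B) in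
/-- The mark of the universal object with a mark at `i`. -/
def genericMark (i : ι) : (generic B i).mark i := ⟨⟨rfl⟩⟩

@[simp] theorem hom_genericMark (i : ι) : (generic B i).hom i (genericMark B i) = 𝟙 (B i) := rfl

/-- The morphism from the universal marked object which classifies a mark. -/
def genericDesc {i : ι} {M : MarkedObj B} (q : M.mark i) : generic B i ⟶ M where
  base := M.hom i q
  map j e := e.down.down ▸ q
  w := by
    rintro j ⟨⟨rfl⟩⟩
    exact (Category.id_comp _).symm

@[simp] theorem genericDesc_map {i : ι} {M : MarkedObj B} (q : M.mark i) :
    (genericDesc q).map i (genericMark B i) = q := rfl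

theorem generic_base {i : ι} {M : MarkedObj B} (f : generic B i ⟶ M) :
    f.base = M.hom i (f.map i (genericMark B i)) := by
  rw [f.w, hom_genericMark]
  exact (Category.id_comp _).symm

theorem generic_hom_ext {i : ι} {M : MarkedObj B} {f g : generic B i ⟶ M}
    (h : f.map i (genericMark B i) = g.map i (genericMark B i)) : f = g :=
  hom_ext (by rw [generic_base, generic_base, h]) (by rintro j ⟨⟨rfl⟩⟩; exact h)

variable (B) in
/-- The universal object with a mark at `i` corepresents the functor of marks at `i`. -/
def genericIso (i : ι) : coyoneda.obj (Opposite.op (generic B i)) ≅ marks B i :=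
  NatIso.ofComponents (fun M ↦
    { hom := TypeCat.ofHom fun f ↦ f.map i (genericMark B i)
      inv := TypeCat.ofHom genericDesc
      hom_inv_id := by ext f; exact generic_hom_ext rfl
      inv_hom_id := by ext q; rfl })

/-- Morphisms out of `generic B i` are marks and morphisms out of `(free B).obj X` are morphisms `X
⟶ M.obj`; under these identifications both maps agree. -/
theorem bijective_freeDesc_comp_iff (i : ι) {X : L} (x : X ⟶ B i) (M : MarkedObj B) :
    Function.Bijective
      (fun g : _ ⟶ M ↦ (freeDesc x : (free B).obj X ⟶ generic B i) ≫ g) ↔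
      Function.Bijective (fun q : M.mark i ↦ x ≫ M.hom i q) := by
  let e : M.mark i ≃ (generic B i ⟶ M) :=
    ⟨genericDesc, fun f ↦ f.map i (genericMark B i), fun _ ↦ rfl, fun _ ↦ generic_hom_ext rfl⟩
  let e' : ((free B).obj X ⟶ M) ≃ (X ⟶ M.obj) :=
    ⟨fun f ↦ f.base, freeDesc, fun _ ↦ free_hom_ext rfl, fun _ ↦ rfl⟩
  have h : (e' ∘ fun g : _ ⟶ M ↦ (freeDesc x : (free B).obj X ⟶ generic B i) ≫ g) ∘ e =
      fun q : M.mark i ↦ x ≫ M.hom i q := rfl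
  rw [← h, e.bijective.of_comp_iff, e'.bijective.of_comp_iff']

section

variable [HasColimitsOfSize.{v, v} L] (κ : Cardinal.{v}) [Fact κ.IsRegular]

/-- The corepresented functor `marks B i` preserves all small colimits, so any regular `κ` works. -/
theorem isCardinalPresentable_generic (i : ι) : IsCardinalPresentable (generic B i) κ :=
  Functor.isCardinalAccessible_of_natIso (genericIso B i).symm κ

theorem isCardinalPresentable_free (K : L) [IsCardinalPresentable K κ] :
    IsCardinalPresentable ((free B).obj K) κ :=
  (freeAdj B).isCardinalPresentable_leftAdjoint_obj κ K

end


variable {L : Type u} [Category.{v} L] [HasColimitsOfSize.{v, v} L] {ι : Type v} {B : ι → L}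

/-- The universal marked object with a mark at `i` and a morphism to the underlying object which
restricts along `c` to the marked morphism. -/
noncomputable abbrev genericUnder (i : ι) {C : L} (c : B i ⟶ C) : MarkedObj B :=
  pushout (freeDesc (𝟙 (B i)) : (free B).obj (B i) ⟶ generic B i) ((free B).map c)

/-- With `genericUnder_condition`, this identifies morphisms out of `genericUnder i c` with
compatible pairs `(q, n)`. -/
theorem exists_genericUnder_desc (i : ι) {C : L} (c : B i ⟶ C) {M : MarkedObj B} (q : M.mark i)
    (n : C ⟶ M.obj) (h : c ≫ n = M.hom i q) :
    ∃ g : genericUnder i c ⟶ M, (pushout.inl _ _ ≫ g).map i (genericMark B i) = q ∧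
      (pushout.inr _ _ ≫ g).base = n := by
  refine ⟨pushout.desc (genericDesc q) (freeDesc n) (free_hom_ext ?_), ?_, ?_⟩
  · exact (Category.id_comp _).trans h.symm
  · rw [pushout.inl_desc, genericDesc_map]
  · rw [pushout.inr_desc, freeDesc_base]

theorem genericUnder_condition (i : ι) {C : L} (c : B i ⟶ C) {M : MarkedObj B}
    (g : genericUnder i c ⟶ M) :
    c ≫ (pushout.inr _ _ ≫ g).base =
      M.hom i ((pushout.inl _ _ ≫ g).map i (genericMark B i)) := by
  rw [← generic_base]
  have := congrArg (fun t ↦ (t ≫ g).base)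
    (pushout.condition (f := (freeDesc (𝟙 (B i)) : (free B).obj (B i) ⟶ generic B i))
      (g := (free B).map c))
  refine Eq.trans ?_ (this.symm.trans ?_)
  · exact (Category.assoc _ _ _).symm
  · exact (congrArg (· ≫ g.base) (Category.id_comp _))

theorem isCardinalPresentable_genericUnder (κ : Cardinal.{v}) [Fact κ.IsRegular] (i : ι) {C : L}
    (c : B i ⟶ C) (hB : IsCardinalPresentable (B i) κ) (hC : IsCardinalPresentable C κ) :
    IsCardinalPresentable (genericUnder i c) κ :=
  isCardinalPresentable_pushout κ _ _ (isCardinalPresentable_free κ _)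
    (isCardinalPresentable_generic κ i) (isCardinalPresentable_free κ _)

/-- Locality with respect to this morphism forces the morphism which is part of the data classified
by `genericUnder i c` to factor through `p`. -/
noncomputable abbrev genericUnderFactor (i : ι) {C C' : L} (c : B i ⟶ C) (p : C ⟶ C') :
    genericUnder i c ⟶ pushout ((free B).map p)
      (pushout.inr (freeDesc (𝟙 (B i)) : (free B).obj (B i) ⟶ generic B i) ((free B).map c)) :=
  pushout.inr _ _

/-- Injectivity is automatic, since a pushout of the epimorphism `(free B).map p` is epi. Only the
existence of the factorization remains. -/
theorem bijective_genericUnderFactor_comp_iff (i : ι) {C C' : L} (c : B i ⟶ C) (p : C ⟶ C')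
    [Epi p] (M : MarkedObj B) :
    Function.Bijective (fun g : _ ⟶ M ↦ genericUnderFactor i c p ≫ g) ↔
      ∀ (q : M.mark i) (n : C ⟶ M.obj), c ≫ n = M.hom i q → ∃ n' : C' ⟶ M.obj, p ≫ n' = n := by
  have : Epi ((free B).map p) :=
    ⟨fun s t h ↦ free_hom_ext ((cancel_epi p).1 (congrArg Hom.base h))⟩
  constructor
  · intro h q n hn
    obtain ⟨g, _, hg⟩ := exists_genericUnder_desc i c q n hn
    obtain ⟨g', rfl⟩ := h.2 g
    refine ⟨(pushout.inl _ _ ≫ g').base, ?_⟩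
    rw [← hg]
    have := congrArg (fun t ↦ (t ≫ g').base) (pushout.condition (f := (free B).map p)
      (g := pushout.inr (freeDesc (𝟙 (B i)) : (free B).obj (B i) ⟶ generic B i) ((free B).map c)))
    exact (Category.assoc _ _ _).symm.trans (this.trans (Category.assoc _ _ _))
  · refine fun h ↦ ⟨fun g g' hg ↦ (cancel_epi _).1 hg, fun g ↦ ?_⟩
    obtain ⟨n', hn'⟩ := h _ _ (genericUnder_condition i c g)
    exact ⟨pushout.desc (freeDesc n') g (free_hom_ext hn'), pushout.inr_desc _ _ _⟩

end MarkedObj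

/-! ### Kan-injectivity as locality -/

section

variable {L : Type u} [Category.{v} L] [OrderEnriched L] {ι : Type v} {X Y B : ι → L}
  {h : ∀ i, X i ⟶ Y i} {x : ∀ i, X i ⟶ B i} {y : ∀ i, Y i ⟶ B i}

theorem IsKanInjective.exists_hom (hB : ∀ i, IsLaxTriangle (h i) (x i) (y i)) {K : L}
    (hK : IsKanInjective (MorphismProperty.ofHoms h) K) (i : ι) (f : X i ⟶ K) :
    ∃ m : B i ⟶ K, x i ≫ m = f ∧ IsKanExtension (h i) f (y i ≫ m) := by
  obtain ⟨e, he⟩ := hK (h i) ⟨i⟩ f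
  obtain ⟨m, rfl, rfl⟩ := (hB i).exists_desc f e he.le
  exact ⟨m, rfl, he⟩

namespace MarkedObj

variable (x y) in
/-- The marked morphisms are exactly the Kan extensions along `h i`, one for each morphism out of
`X i`. -/
structure IsKan (M : MarkedObj B) : Prop where
  bijective (i : ι) : Function.Bijective (fun q : M.mark i ↦ x i ≫ M.hom i q)
  le (i : ι) (q : M.mark i) (n : B i ⟶ M.obj) (hn : x i ≫ n = x i ≫ M.hom i q) :
    y i ≫ M.hom i q ≤ y i ≫ n

/-- Each competitor `g` is `y i ≫ n` for some `n` out of the lax triangle, so comparing with such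
`n` suffices. -/
theorem IsKan.isKanExtension (hB : ∀ i, IsLaxTriangle (h i) (x i) (y i)) {M : MarkedObj B}
    (hM : IsKan x y M) (i : ι) (q : M.mark i) :
    IsKanExtension (h i) (x i ≫ M.hom i q) (y i ≫ M.hom i q) where
  le := (hB i).comp_le _
  least g hg := by
    obtain ⟨n, hn, rfl⟩ := (hB i).exists_desc _ _ hg
    exact hM.le i q n hn

theorem IsKan.isKanInjective (hB : ∀ i, IsLaxTriangle (h i) (x i) (y i)) {M : MarkedObj B}
    (hM : IsKan x y M) : IsKanInjective (MorphismProperty.ofHoms h) M.obj := by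
  rintro _ _ _ ⟨i⟩ f
  obtain ⟨q, rfl⟩ := (hM.bijective i).2 f
  exact ⟨_, hM.isKanExtension hB i q⟩

theorem exists_isLocal_eq_isKan [HasColimitsOfSize.{v, v} L] [∀ K : L, IsPresentable.{v} K]
    (hT : ∀ X : L, ∃ (T : L) (i₀ i₁ : X ⟶ T), IsChainCopower i₀ i₁)
    (x : ∀ i, X i ⟶ B i) (y : ∀ i, Y i ⟶ B i) :
    ∃ W : MorphismProperty (MarkedObj B), W.isLocal.ι.IsRightAdjoint ∧
      W.isLocal = IsKan x y := by
  -- A morphism out of `pushout (x i) (x i)` is a pair `m`, `n` agreeing on `X i`; it factors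
  -- through `p i` exactly when `y i ≫ m ≤ y i ≫ n`.
  choose C p hp hpm using fun i ↦ exists_coinserter hT
    (y i ≫ pushout.inl (x i) (x i)) (y i ≫ pushout.inr (x i) (x i))
  obtain ⟨κ, _, hκ⟩ := exists_isCardinalPresentable_family
    (Sum.elim X (Sum.elim B (Sum.elim C fun i ↦ pushout (x i) (x i))))
  have hX (i : ι) : IsCardinalPresentable (X i) κ := hκ (.inl i)
  have hB (i : ι) : IsCardinalPresentable (B i) κ := hκ (.inr (.inl i))
  have hC (i : ι) : IsCardinalPresentable (C i) κ := hκ (.inr (.inr (.inl i)))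
  have hP (i : ι) : IsCardinalPresentable (pushout (x i) (x i)) κ := hκ (.inr (.inr (.inr i)))
  let w : ι ⊕ ι → Arrow (MarkedObj B) := Sum.elim
    (fun i ↦ Arrow.mk (freeDesc (x i) : (free B).obj (X i) ⟶ generic B i))
    -- Taking `c` to be `pushout.inl` forces the first member of the pair to be a marked morphism,
    -- while the second is arbitrary.
    (fun i ↦ Arrow.mk (genericUnderFactor i (pushout.inl (x i) (x i)) (p i)))
  let W := MorphismProperty.ofHoms fun j ↦ (w j).hom
  refine ⟨W, W.isRightAdjoint_ι_isLocal κ ?_, ?_⟩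
  · rintro _ _ _ ⟨i | i⟩
    · exact ⟨isCardinalPresentable_free κ _, isCardinalPresentable_generic κ i⟩
    · have := isCardinalPresentable_genericUnder κ i (pushout.inl (x i) (x i)) (hB i) (hP i)
      exact ⟨this, isCardinalPresentable_pushout κ _ _ (isCardinalPresentable_free κ _)
        (isCardinalPresentable_free κ _) this⟩
  · ext M
    have key (i : ι) := bijective_genericUnderFactor_comp_iff i (pushout.inl (x i) (x i)) (p i) M
    have hW : W.isLocal M ↔ ∀ j, Function.Bijective (fun g : _ ⟶ M ↦ (w j).hom ≫ g) :=
      ⟨fun H j ↦ H _ ⟨j⟩, by rintro H _ _ _ ⟨j⟩; exact H j⟩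
    rw [hW, Sum.forall]
    constructor
    · rintro ⟨h₁, h₂⟩
      refine ⟨fun i ↦ (bijective_freeDesc_comp_iff i (x i) M).1 (h₁ i), fun i q n hn ↦ ?_⟩
      have := (hpm i (pushout.desc _ n hn.symm)).2
        ((key i).1 (h₂ i) q _ (pushout.inl_desc _ _ _))
      simpa [pushout.inl_desc, pushout.inr_desc] using this
    · rintro ⟨h₁, h₂⟩
      refine ⟨fun i ↦ (bijective_freeDesc_comp_iff i (x i) M).2 (h₁ i),
        fun i ↦ (key i).2 fun q n hn ↦ (hpm i n).1 ?_⟩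
      rw [Category.assoc, hn, Category.assoc]
      refine h₂ i q _ ?_
      rw [← hn, pushout.condition_assoc]

end MarkedObj

/-! ### The full embedding into marked objects -/

namespace KanInj

/-- A Kan-injective object, marked with its Kan extensions. -/
@[simps]
noncomputable def toMarkedObj (hB : ∀ i, IsLaxTriangle (h i) (x i) (y i)) :
    KanInj (MorphismProperty.ofHoms h) ⥤ MarkedObj B where
  obj K :=
    { obj := K.obj
      mark i := X i ⟶ K.obj
      -- The choice is canonical: both restrictions are determined, by `f` and by uniqueness of Kan
      -- extensions.
      hom i f := (K.isKanInjective.exists_hom hB i f).choose }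
  map {K K'} u :=
    { base := u.hom
      map i f := f ≫ u.hom
      w i f := by
        obtain ⟨h₁, h₂⟩ := (K.isKanInjective.exists_hom hB i f).choose_spec
        obtain ⟨h₁', h₂'⟩ := (K'.isKanInjective.exists_hom hB i (f ≫ u.hom)).choose_spec
        refine (hB i).hom_ext _ _ ?_ ?_
        · rw [h₁', reassoc_of% h₁]
        · rw [← Category.assoc]
          exact h₂'.unique (u.preserves _ ⟨i⟩ _ _ h₂) }
  map_id K := MarkedObj.hom_ext rfl fun i f ↦ Category.comp_id f
  map_comp u u' := MarkedObj.hom_ext rfl fun i f ↦ (Category.assoc f u.hom u'.hom).symm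

variable (hB : ∀ i, IsLaxTriangle (h i) (x i) (y i))

theorem comp_toMarkedObj_hom (K : KanInj (MorphismProperty.ofHoms h)) (i : ι) (f : X i ⟶ K.obj) :
    x i ≫ ((toMarkedObj hB).obj K).hom i f = f :=
  (K.isKanInjective.exists_hom hB i f).choose_spec.1

theorem isKanExtension_toMarkedObj_hom (K : KanInj (MorphismProperty.ofHoms h)) (i : ι)
    (f : X i ⟶ K.obj) : IsKanExtension (h i) f (y i ≫ ((toMarkedObj hB).obj K).hom i f) :=
  (K.isKanInjective.exists_hom hB i f).choose_spec.2

theorem isKan_toMarkedObj (K : KanInj (MorphismProperty.ofHoms h)) :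
    MarkedObj.IsKan x y ((toMarkedObj hB).obj K) where
  bijective i := by
    have : (fun f : X i ⟶ K.obj ↦ x i ≫ ((toMarkedObj hB).obj K).hom i f) = id :=
      funext (comp_toMarkedObj_hom hB K i)
    exact this ▸ Function.bijective_id
  le i f n hn := by
    refine (isKanExtension_toMarkedObj_hom hB K i f).least _ ?_
    rw [← (hn.trans (comp_toMarkedObj_hom hB K i f) : x i ≫ n = f)]
    exact (hB i).comp_le n

instance : (toMarkedObj hB).Faithful where
  map_injective h := Hom.ext (congrArg MarkedObj.Hom.base h)

/-- Restricting `g.w` along `x i` forces `g.map i f = f ≫ g.base`; restricting it along `y i` then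
says that `g.base` preserves Kan extensions. -/
instance : (toMarkedObj hB).Full where
  map_surjective {K K'} g := by
    have hg (i : ι) (f : X i ⟶ K.obj) : g.map i f = f ≫ g.base := by
      refine (comp_toMarkedObj_hom hB K' i (g.map i f)).symm.trans ?_
      refine (congrArg (x i ≫ ·) (g.w i f)).trans ?_
      refine (Category.assoc _ _ _).symm.trans ?_
      exact congrArg (· ≫ g.base) (comp_toMarkedObj_hom hB K i f)
    refine ⟨⟨g.base, ?_⟩, MarkedObj.hom_ext rfl fun i f ↦ (hg i f).symm⟩
    rintro _ _ _ ⟨i⟩ f e he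
    have h₁ := isKanExtension_toMarkedObj_hom hB K' i (g.map i f)
    have h₂ : y i ≫ ((toMarkedObj hB).obj K').hom i (g.map i f) = e ≫ g.base := by
      refine (congrArg (y i ≫ ·) (g.w i f)).trans ((Category.assoc _ _ _).symm.trans ?_)
      exact congrArg (· ≫ g.base) ((isKanExtension_toMarkedObj_hom hB K i f).unique he)
    exact h₂ ▸ hg i f ▸ h₁

/-- Bijectivity in `IsKan` relabels marks by morphisms out of `X i`, and uniqueness of Kan
extensions matches the marked morphisms. -/
theorem exists_iso_toMarkedObj {M : MarkedObj B} (hM : MarkedObj.IsKan x y M) :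
    ∃ K, Nonempty ((toMarkedObj hB).obj K ≅ M) := by
  let K : KanInj (MorphismProperty.ofHoms h) := ⟨M.obj, hM.isKanInjective hB⟩
  let e (i : ι) : M.mark i ≃ (X i ⟶ M.obj) := Equiv.ofBijective _ (hM.bijective i)
  have he (i : ι) (q : M.mark i) : ((toMarkedObj hB).obj K).hom i (e i q) = M.hom i q :=
    (hB i).hom_ext _ _ (comp_toMarkedObj_hom hB K i (e i q))
      ((isKanExtension_toMarkedObj_hom hB K i (e i q)).unique (hM.isKanExtension hB i q))
  refine ⟨K, ⟨⟨𝟙 M.obj, fun i f ↦ (e i).symm f, fun i f ↦ ?_⟩,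
    ⟨𝟙 M.obj, fun i q ↦ e i q, fun i q ↦ ?_⟩, ?_, ?_⟩⟩
  · refine (he i _).symm.trans (Eq.trans ?_ (Category.comp_id _).symm)
    exact congrArg (((toMarkedObj hB).obj K).hom i) ((e i).apply_symm_apply f)
  · exact (he i q).trans (Category.comp_id _).symm
  · exact MarkedObj.hom_ext (Category.comp_id _) fun i f ↦ (e i).apply_symm_apply f
  · exact MarkedObj.hom_ext (Category.comp_id _) fun i q ↦ (e i).symm_apply_apply q

end KanInj

end

theorem proposition4p4 {L : Type u} [Category.{v} L] [OrderEnriched L]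
    (hL : IsOrderEnrichedLocallyPresentable L)
    (H : MorphismProperty L) [MorphismProperty.IsSmall.{v} H] :
    (KanInj.embedding H).IsRightAdjoint := by
  obtain ⟨κ, _, hκ⟩ := hL
  have := hκ.locallyPresentable
  have : IsLocallyPresentable.{v} L := ⟨κ, inferInstance, inferInstance⟩
  obtain ⟨ι, X, Y, h, rfl⟩ := (MorphismProperty.isSmall_iff_eq_ofHoms.{v} H).1 inferInstance
  choose B x y hB using fun i ↦ exists_isLaxTriangle hκ.exists_copower (h i)
  obtain ⟨W, _, hW⟩ := MarkedObj.exists_isLocal_eq_isKan hκ.exists_copower x y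
  let G := W.isLocal.lift (KanInj.toMarkedObj hB)
    fun K ↦ by rw [hW]; exact KanInj.isKan_toMarkedObj hB K
  have : G.EssSurj := ⟨fun M ↦ by
    obtain ⟨K, ⟨e⟩⟩ := KanInj.exists_iso_toMarkedObj hB (M := M.obj) (hW ▸ M.property)
    exact ⟨K, ⟨W.isLocal.isoMk e⟩⟩⟩
  have : G.IsEquivalence := { }
  have : (MarkedObj.forget B).IsRightAdjoint := (MarkedObj.freeAdj B).isRightAdjoint
  -- The embedding is an equivalence, a reflective inclusion and a forgetful functor composed, all
  -- right adjoints.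
  exact Functor.isRightAdjoint_of_iso
    (Iso.refl _ : G ⋙ W.isLocal.ι ⋙ MarkedObj.forget B ≅ KanInj.embedding _)
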